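/- Let $R$ be a complete, separated topological associative ring with unit, in which the open right ideals form a base of neighborhoods of zero. For a set $X$, let $R[[X]]$ be the set of all formal linear combinations $\sum_{x\in X} r_x x$ whose coefficients $r_x\in R$ form a family converging to zero (every neighborhood of zero in $R$ contains all but finitely many of the $r_x$). The functor $X\mapsto R[[X]]$ is a monad on the category of sets, with unit $x_0\mapsto 1\cdot x_0$ and with multiplication $R[[R[[X]]]]\to R[[X]]$ opening the parentheses: $\sum_s r_s s\mapsto\sum_x\bigl(\sum_s r_s s_x\bigr)x$, where $s=\sum_x s_x x$. A left $R$-contramodule is an algebra over this monad; these algebras form the category of left $R$-contramodules. Regard $R=R[[\{*\}]]$ as the free left $R$-contramodule with one generator. Let $a_1,a_2,a_3,\dots$ be a sequence of elements of $R$, and let $$B=\varinjlim\bigl(R\xrightarrow{\,*a_1\,}R\xrightarrow{\,*a_2\,}R\xrightarrow{\,*a_3\,}\cdots\bigr)$$ be the associated Bass flat left $R$-contramodule, that is, the direct limit, in the category of left $R$-contramodules, of the sequence of right multiplication maps $r\mapsto ra_n$. Proposition. If $B$ is a projective object of the category of left $R$-contramodules, then for every open right ideal $I\subset R$ the descending chain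 of right ideals $$R\supset a_1R+I\supset a_1a_2R+I\supset a_1a_2a_3R+I\supset\cdots$$ terminates: there is an $m\ge 0$ such that $a_1\cdots a_nR+I=a_1\cdots a_mR+I$ for all $n\ge m$. -/

import Mathlib

open CategoryTheory CategoryTheory.Limits Filter Topology

universe u

/-- The set `R[[X]]` of all formal linear combinations `∑ r_x x` of elements of `X` whose
coefficients form an `X`-indexed family converging to zero in the topology of `R`. -/
def ConvFam (R : Type*) [Zero R] [TopologicalSpace R] (X : Type*) : Type _ :=
  {r : X → R // Tendsto r cofinite (𝓝 0)}

namespace ConvFam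

section Sums

variable {R : Type*} [Ring R] [UniformSpace R] [IsUniformAddGroup R] [IsTopologicalRing R]
  [IsLinearTopology Rᵐᵒᵖ R]

/-- Convergence to zero may be tested on open right ideals. -/
theorem tendsto_iff {X : Type*} (g : X → R) :
    Tendsto g cofinite (𝓝 0) ↔
      ∀ I : Submodule Rᵐᵒᵖ R, IsOpen (I : Set R) → {x | g x ∉ I}.Finite := by
  rw [(IsLinearTopology.hasBasis_open_submodule (M := R) Rᵐᵒᵖ).tendsto_right_iff]
  simp only [Filter.eventually_cofinite, SetLike.mem_coe]

theorem tendsto_mul {X : Type*} {g : X → R} (hg : Tendsto g cofinite (𝓝 0)) (φ : X → R) :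
    Tendsto (fun x => g x * φ x) cofinite (𝓝 0) := by
  rw [tendsto_iff] at hg ⊢
  refine fun I hI => (hg I hI).subset fun x hx hgx => hx ?_
  exact I.smul_mem (MulOpposite.op (φ x)) hgx

theorem tsum_mem {X : Type*} (I : Submodule Rᵐᵒᵖ R) (hI : IsOpen (I : Set R)) {g : X → R}
    (hg : ∀ x, g x ∈ I) : ∑' x, g x ∈ I := by
  have hc : IsClosed (I : Set R) := I.toAddSubgroup.isClosed_of_isOpen hI
  by_cases hs : Summable g
  · exact hc.mem_of_tendsto hs.hasSum
      (Eventually.of_forall fun s => I.sum_mem fun x _ => hg x)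
  · rw [tsum_eq_zero_of_not_summable hs]
    exact I.zero_mem

theorem tendsto_tsum {Y : Type*} {β : Y → Type*} {g : (Σ y, β y) → R}
    (hg : Tendsto g cofinite (𝓝 0)) :
    Tendsto (fun y => ∑' z, g ⟨y, z⟩) cofinite (𝓝 0) := by
  rw [tendsto_iff] at hg ⊢
  intro I hI
  refine ((hg I hI).image Sigma.fst).subset fun y hy => ?_
  by_contra hcon
  refine hy (tsum_mem I hI fun z => ?_)
  by_contra hz
  exact hcon ⟨⟨y, z⟩, hz, rfl⟩

/-- The doubly indexed family arising when parentheses are opened converges to zero. -/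
theorem tendsto_double {S X : Type*} {r : S → R} (hr : Tendsto r cofinite (𝓝 0))
    {c : S → X → R} (hc : ∀ s, Tendsto (c s) cofinite (𝓝 0)) :
    Tendsto (fun p : S × X => r p.1 * c p.1 p.2) cofinite (𝓝 0) := by
  rw [tendsto_iff] at hr ⊢
  intro I hI
  have h : ∀ s, {x | r s * c s x ∉ I}.Finite := by
    intro s
    have : Tendsto (fun x => r s * c s x) cofinite (𝓝 0) := by
      simpa using (hc s).const_mul (r s)
    exact (tendsto_iff _).1 this I hI
  refine ((hr I hI).biUnion fun s _ => (h s).image (Prod.mk s)).subset ?_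
  rintro ⟨s, x⟩ hp
  simp only [Set.mem_iUnion]
  refine ⟨s, fun hs => hp ?_, x, hp, rfl⟩
  exact I.smul_mem (MulOpposite.op (c s x)) hs

variable [CompleteSpace R] [T2Space R]

theorem summable_of_tendsto {X : Type*} {g : X → R} (hg : Tendsto g cofinite (𝓝 0)) :
    Summable g := by
  have : NonarchimedeanAddGroup R :=
    { is_nonarchimedean := fun U hU => by
        obtain ⟨I, hI, hIU⟩ :=
          (IsLinearTopology.hasBasis_open_submodule (M := R) Rᵐᵒᵖ).mem_iff.1 hU
        exact ⟨⟨I.toAddSubgroup, hI⟩, hIU⟩ }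
  exact NonarchimedeanAddGroup.summable_of_tendsto_cofinite_zero hg


/-- The pairing `∑ r_x φ(x)` of a convergent family with an arbitrary function. -/
noncomputable def pair {X : Type*} (r : ConvFam R X) (φ : X → R) : R := ∑' x, r.1 x * φ x

open Classical in
/-- The "point measure" `1 · x₀`. -/
noncomputable def point (R : Type*) [Ring R] [TopologicalSpace R] {X : Type*} (x₀ : X) :
    ConvFam R X :=
  ⟨Pi.single x₀ 1, by
    refine tendsto_nhds_of_eventually_eq ?_
    rw [Filter.eventually_cofinite]
    refine (Set.finite_singleton x₀).subset fun x hx => ?_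
    by_contra h
    exact hx (Pi.single_eq_of_ne h _)⟩

/-- The map `R[[f]] : R[[X]] → R[[Y]]`, sending `∑ r_x x` to `∑_y (∑_{f x = y} r_x) y`. -/
noncomputable def map {X Y : Type*} (f : X → Y) (r : ConvFam R X) : ConvFam R Y :=
  ⟨fun y => ∑' x : {x // f x = y}, r.1 x,
    tendsto_tsum (g := fun p : Σ y, {x // f x = y} => r.1 p.2)
      (r.2.comp (Equiv.sigmaFiberEquiv f).injective.tendsto_cofinite)⟩

/-- The "opening of parentheses" map `R[[R[[X]]]] → R[[X]]`: the coefficient of the image of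
`∑_s r_s s` at `x` is `∑_s r_s s_x`, where `s = ∑_x s_x x`. -/
noncomputable def join {X : Type*} (r : ConvFam R (ConvFam R X)) : ConvFam R X :=
  ⟨fun x => ∑' s : ConvFam R X, r.1 s * s.1 x,
    tendsto_tsum (g := fun p : Σ _ : X, ConvFam R X => r.1 p.2 * p.2.1 p.1)
      ((tendsto_double r.2 (c := fun s x => s.1 x) fun s => s.2).comp
        (((Equiv.sigmaEquivProd _ _).trans (Equiv.prodComm _ _)).injective.tendsto_cofinite))⟩

theorem tsum_sigma_of_tendsto {Y : Type*} {β : Y → Type*} {g : (Σ y, β y) → R}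
    (hg : Tendsto g cofinite (𝓝 0)) : ∑' y, ∑' z, g ⟨y, z⟩ = ∑' p, g p :=
  (summable_of_tendsto hg).tsum_sigma.symm

theorem pair_map {X Y : Type*} (f : X → Y) (r : ConvFam R X) (φ : Y → R) :
    pair (map f r) φ = pair r (φ ∘ f) := by
  have h1 : Tendsto (fun x => r.1 x * φ (f x)) cofinite (𝓝 0) := tendsto_mul r.2 _
  have h2 : Tendsto (fun p : Σ y, {x // f x = y} => r.1 p.2 * φ (f p.2)) cofinite (𝓝 0) :=
    h1.comp (Equiv.sigmaFiberEquiv f).injective.tendsto_cofinite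
  have h3 := (Equiv.sigmaFiberEquiv f).tsum_eq (fun x => r.1 x * φ (f x))
  have h4 := tsum_sigma_of_tendsto h2
  unfold pair
  simp only [Function.comp_apply]
  rw [← h3]
  refine Eq.trans ?_ h4
  refine tsum_congr fun y => ?_
  have hr : Summable fun x : {x // f x = y} => r.1 x :=
    summable_of_tendsto (r.2.comp Subtype.val_injective.tendsto_cofinite)
  refine (hr.tsum_mul_right (φ y)).symm.trans (tsum_congr fun x => ?_)
  rw [x.2]

theorem pair_join {X : Type*} (r : ConvFam R (ConvFam R X)) (φ : X → R) :
    pair (join r) φ = pair r fun s => pair s φ := by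
  have h1 : Tendsto (fun p : ConvFam R X × X => r.1 p.1 * (p.1.1 p.2 * φ p.2)) cofinite (𝓝 0) :=
    tendsto_double r.2 (c := fun s x => s.1 x * φ x) fun s => tendsto_mul s.2 φ
  have h2 : ∀ x, Summable fun s : ConvFam R X => r.1 s * s.1 x := fun x =>
    summable_of_tendsto (tendsto_mul r.2 fun s => s.1 x)
  have h3 : ∀ s : ConvFam R X, Summable fun x => s.1 x * φ x := fun s =>
    summable_of_tendsto (tendsto_mul s.2 φ)
  have h4 := (summable_of_tendsto h1).tsum_comm (f := fun s x => r.1 s * (s.1 x * φ x))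
  unfold pair
  calc ∑' x, (join r).1 x * φ x = ∑' x, ∑' s : ConvFam R X, r.1 s * (s.1 x * φ x) := by
        refine tsum_congr fun x => ?_
        refine ((h2 x).tsum_mul_right (φ x)).symm.trans (tsum_congr fun s => ?_)
        rw [mul_assoc]
    _ = ∑' s : ConvFam R X, ∑' x, r.1 s * (s.1 x * φ x) := h4
    _ = _ := tsum_congr fun s => (h3 s).tsum_mul_left (r.1 s)

open Classical in
theorem map_apply {X Y : Type*} (f : X → Y) (r : ConvFam R X) (y : Y) :
    (map f r).1 y = pair r fun x => if f x = y then 1 else 0 := by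
  unfold pair map
  refine (tsum_subtype {x | f x = y} r.1).trans (tsum_congr fun x => ?_)
  by_cases h : f x = y <;> simp [Set.indicator, h]

theorem join_apply {X : Type*} (r : ConvFam R (ConvFam R X)) (x : X) :
    (join r).1 x = pair r fun s => s.1 x := rfl

theorem pair_point {X : Type*} (x : X) (φ : X → R) : pair (point R x) φ = φ x := by
  classical
  unfold pair point
  rw [tsum_eq_single x fun y hy => by simp [Pi.single_eq_of_ne hy]]
  simp

open Classical in
theorem point_apply {X : Type*} (x y : X) :
    (point R x).1 y = if x = y then 1 else 0 := by
  simp [point, Pi.single_apply, eq_comm]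

theorem join_map {X Y : Type*} (f : X → ConvFam R Y) (r : ConvFam R X) (y : Y) :
    (join (map f r)).1 y = pair r fun s => (f s).1 y := by
  rw [join_apply, pair_map]
  rfl

/-- Multiplication of all coefficients by `a` on the right. -/
def mulRight (a : R) {X : Type*} (r : ConvFam R X) : ConvFam R X :=
  ⟨fun x => r.1 x * a, tendsto_mul r.2 fun _ => a⟩

theorem join_map_mulRight (a : R) {X : Type*} (r : ConvFam R (ConvFam R X)) :
    join (map (mulRight a) r) = mulRight a (join r) := by
  refine Subtype.ext (funext fun x => ?_)
  have h2 : Summable fun s : ConvFam R X => r.1 s * s.1 x :=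
    summable_of_tendsto (tendsto_mul r.2 fun s => s.1 x)
  refine (join_map _ _ _).trans (Eq.trans (tsum_congr fun s => ?_) (h2.tsum_mul_right a))
  exact (mul_assoc _ _ _).symm

open Classical in
theorem pair_indicator {X : Type*} (r : ConvFam R X) (y : X) :
    (pair r fun x => if x = y then 1 else 0) = r.1 y := by
  unfold pair
  rw [tsum_eq_single y fun x hx => by simp [hx]]
  simp

theorem map_id {X : Type*} (r : ConvFam R X) : map (fun x => x) r = r := by
  classical
  exact Subtype.ext (funext fun y => (map_apply _ _ _).trans (pair_indicator r y))

theorem map_map {X Y Z : Type*} (f : X → Y) (g : Y → Z) (r : ConvFam R X) :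
    map (fun x => g (f x)) r = map g (map f r) := by
  refine Subtype.ext (funext fun z => ?_)
  rw [map_apply, map_apply g, pair_map]
  rfl

theorem point_naturality {X Y : Type*} (f : X → Y) (x : X) :
    point R (f x) = map f (point R x) := by
  refine Subtype.ext (funext fun y => ?_)
  rw [map_apply, pair_point, point_apply]

theorem join_naturality {X Y : Type*} (f : X → Y) (r : ConvFam R (ConvFam R X)) :
    join (map (map f) r) = map f (join r) := by
  refine Subtype.ext (funext fun y => ?_)
  rw [join_map, map_apply, pair_join]
  congr 1
  funext s
  exact map_apply _ _ _

theorem join_assoc {X : Type*} (r : ConvFam R (ConvFam R (ConvFam R X))) :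
    join (map join r) = join (join r) := by
  refine Subtype.ext (funext fun y => ?_)
  rw [join_map, join_apply (join r), pair_join]
  rfl

theorem join_point {X : Type*} (r : ConvFam R X) : join (point R r) = r := by
  refine Subtype.ext (funext fun y => ?_)
  rw [join_apply, pair_point]

theorem join_map_point {X : Type*} (r : ConvFam R X) : join (map (point R) r) = r := by
  refine Subtype.ext (funext fun y => ?_)
  rw [join_map]
  refine Eq.trans ?_ (pair_indicator r y)
  congr 1
  funext x
  exact point_apply _ _

end Sums
end ConvFam

section Colimits

variable {T : Monad (Type u)} {J : Type} [Category.{0} J] (F : J ⥤ T.Algebra)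

namespace AlgebraColimit

/-- The disjoint union of the underlying sets of a diagram of algebras. -/
abbrev Gen : Type u := Σ j, (F.obj j).A

/-- The map from the free algebra on the disjoint union to the vertex of a cocone. -/
def toPt (c : Cocone F) : T.obj (Gen F) ⟶ c.pt.A :=
  T.map (TypeCat.ofHom fun x : Gen F => (c.ι.app x.1).f x.2) ≫ c.pt.a

/-- Two elements of the free algebra are identified if they are so in every cocone. -/
def rel : Setoid (T.obj (Gen F)) where
  r x y := ∀ c : Cocone F, toPt F c x = toPt F c y
  iseqv := ⟨fun _ _ => rfl, fun h c => (h c).symm, fun h h' c => (h c).trans (h' c)⟩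

/-- The underlying set of the colimit. -/
abbrev Carrier : Type u := Quotient (rel F)

/-- The projection from the free algebra. -/
def proj : T.obj (Gen F) ⟶ Carrier F := TypeCat.ofHom (Quotient.mk (rel F))

/-- The induced map to the vertex of a cocone. -/
def descFun (c : Cocone F) : Carrier F ⟶ c.pt.A :=
  TypeCat.ofHom (Quotient.lift (toPt F c) fun _ _ h => h c)

theorem proj_desc (c : Cocone F) : proj F ≫ descFun F c = toPt F c := rfl

theorem mu_toPt (c : Cocone F) :
    T.μ.app (Gen F) ≫ toPt F c = T.map (toPt F c) ≫ c.pt.a := by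
  unfold toPt
  rw [← Category.assoc, ← T.μ.naturality, Category.assoc, c.pt.assoc]
  simp

theorem desc_jointly {X : Type u} {f g : X ⟶ Carrier F}
    (h : ∀ c, f ≫ descFun F c = g ≫ descFun F c) : f = g := by
  ext x : 3
  obtain ⟨a, ha⟩ := Quotient.exists_rep (f x)
  obtain ⟨b, hb⟩ := Quotient.exists_rep (g x)
  refine ha.symm.trans (Eq.trans (Quotient.sound fun c => ?_) hb)
  have := ConcreteCategory.congr_hom (h c) x
  change descFun F c (f x) = descFun F c (g x) at this
  rw [← ha, ← hb] at this
  exact this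

/-- A set-theoretic section of the projection. -/
noncomputable def sec : Carrier F ⟶ T.obj (Gen F) := TypeCat.ofHom Quotient.out

theorem sec_proj : sec F ≫ proj F = 𝟙 _ := by
  ext x : 3
  exact Quotient.out_eq x

/-- The structure map of the colimit. -/
noncomputable def act : T.obj (Carrier F) ⟶ Carrier F :=
  T.map (sec F) ≫ T.μ.app (Gen F) ≫ proj F

theorem sec_toPt (c : Cocone F) : sec F ≫ toPt F c = descFun F c := by
  rw [← proj_desc, ← Category.assoc, sec_proj, Category.id_comp]

theorem act_desc (c : Cocone F) : act F ≫ descFun F c = T.map (descFun F c) ≫ c.pt.a := by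
  unfold act
  rw [Category.assoc, Category.assoc, proj_desc, mu_toPt, ← Category.assoc, ← T.map_comp,
    sec_toPt]

/-- The colimit algebra. -/
noncomputable def alg : T.Algebra where
  A := Carrier F
  a := act F
  unit := by
    refine desc_jointly F fun c => ?_
    rw [Category.assoc, act_desc, ← Category.assoc, ← T.η.naturality, Category.assoc, c.pt.unit]
    simp
  assoc := by
    refine desc_jointly F fun c => ?_
    rw [Category.assoc, Category.assoc, act_desc, ← Category.assoc, ← Category.assoc,
      ← T.μ.naturality, ← T.map_comp, act_desc, Category.assoc, c.pt.assoc]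
    simp

/-- The maps of the colimit cocone. -/
noncomputable def inc (j : J) : (F.obj j).A ⟶ Carrier F :=
  TypeCat.ofHom (fun x => (⟨j, x⟩ : Gen F)) ≫ T.η.app (Gen F) ≫ proj F

theorem inc_desc (j : J) (c : Cocone F) : inc F j ≫ descFun F c = (c.ι.app j).f := by
  unfold inc
  rw [Category.assoc, Category.assoc, proj_desc]
  unfold toPt
  rw [← Category.assoc (T.η.app _), ← T.η.naturality, Category.assoc, c.pt.unit]
  rfl

theorem inc_hom (j : J) : T.map (inc F j) ≫ act F = (F.obj j).a ≫ inc F j := by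
  refine desc_jointly F fun c => ?_
  rw [Category.assoc, act_desc, ← Category.assoc, ← T.map_comp, inc_desc,
    Category.assoc, inc_desc]
  exact (c.ι.app j).h

theorem inc_naturality {i j : J} (f : i ⟶ j) : (F.map f).f ≫ inc F j = inc F i := by
  refine desc_jointly F fun c => ?_
  rw [Category.assoc, inc_desc, inc_desc]
  exact congrArg Monad.Algebra.Hom.f (c.w f)

/-- The maps `inc F j` together. -/
noncomputable def genInc : Gen F ⟶ Carrier F := TypeCat.ofHom fun x => inc F x.1 x.2

theorem genInc_desc (c : Cocone F) : genInc F ≫ descFun F c =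
    TypeCat.ofHom fun x : Gen F => (c.ι.app x.1).f x.2 := by
  ext x : 3
  exact ConcreteCategory.congr_hom (inc_desc F x.1 c) x.2

theorem proj_eq : proj F = T.map (genInc F) ≫ act F := by
  refine desc_jointly F fun c => ?_
  rw [Category.assoc, act_desc, ← Category.assoc, ← T.map_comp, genInc_desc, proj_desc]
  rfl

theorem desc_unique (c : Cocone F) (m : Carrier F ⟶ c.pt.A)
    (h : T.map m ≫ c.pt.a = act F ≫ m) (hm : ∀ j, inc F j ≫ m = (c.ι.app j).f) :
    m = descFun F c := by
  have hg : genInc F ≫ m = TypeCat.ofHom fun x : Gen F => (c.ι.app x.1).f x.2 := by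
    ext x : 3
    exact ConcreteCategory.congr_hom (hm x.1) x.2
  have key : proj F ≫ m = toPt F c := by
    rw [proj_eq, Category.assoc, ← h, ← Category.assoc, ← T.map_comp, hg]
    rfl
  rw [← sec_toPt, ← key, ← Category.assoc, sec_proj, Category.id_comp]

/-- The colimit cocone. -/
noncomputable def cocone : Cocone F where
  pt := alg F
  ι :=
    { app := fun j => { f := inc F j, h := inc_hom F j }
      naturality := fun _ _ f => Monad.Algebra.Hom.ext (inc_naturality F f) }

/-- The universal property of the colimit cocone. -/
noncomputable def isColimit : IsColimit (cocone F) where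
  desc c := { f := descFun F c, h := (act_desc F c).symm }
  fac c j := Monad.Algebra.Hom.ext (inc_desc F j c)
  uniq c m hm := Monad.Algebra.Hom.ext <|
    desc_unique F c m.f m.h fun j => congrArg Monad.Algebra.Hom.f (hm j)

end AlgebraColimit

theorem hasColimit_algebra : HasColimit F :=
  ⟨⟨⟨AlgebraColimit.cocone F, AlgebraColimit.isColimit F⟩⟩⟩

end Colimits

section Contramodules

variable (R : Type u) [Ring R] [UniformSpace R] [IsUniformAddGroup R] [IsTopologicalRing R]
  [CompleteSpace R] [T2Space R] [IsLinearTopology Rᵐᵒᵖ R]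

open ConvFam

/-- The monad `X ↦ R[[X]]` on the category of sets. -/
noncomputable def contraMonad : Monad (Type u) where
  obj X := ConvFam R X
  map f := TypeCat.ofHom (ConvFam.map f)
  map_id X := by ext r : 3; exact ConvFam.map_id (R := R) r
  map_comp f g := by ext r : 3; exact ConvFam.map_map (R := R) f g r
  η :=
    { app := fun X => TypeCat.ofHom (point R)
      naturality := fun X Y f => by ext x : 3; exact point_naturality (R := R) f x }
  μ :=
    { app := fun X => TypeCat.ofHom join
      naturality := fun X Y f => by ext r : 3; exact join_naturality (R := R) f r }
  assoc X := by ext r : 3; exact join_assoc (R := R) r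
  left_unit X := by ext r : 3; exact join_point (R := R) r
  right_unit X := by ext r : 3; exact join_map_point (R := R) r

/-- The category `R-contra` of left `R`-contramodules: algebras over the monad `X ↦ R[[X]]`. -/
abbrev Contramodule : Type (u + 1) := (contraMonad R).Algebra

/-- `R` viewed as the free left `R`-contramodule with one generator. -/
noncomputable abbrev freeOne : Contramodule R := (contraMonad R).free.obj PUnit.{u + 1}

variable {R}

/-- Right multiplication by `a`, a contramodule endomorphism of `R`. -/
noncomputable def rightMul (a : R) : freeOne R ⟶ freeOne R where
  f := TypeCat.ofHom (mulRight a : ConvFam R PUnit.{u + 1} → ConvFam R PUnit.{u + 1})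
  h := by
    ext r : 3
    exact join_map_mulRight a r

/-- The sequence `R → R → R → ⋯` of right multiplications by `a 0, a 1, a 2, …`. -/
noncomputable def bassDiagram (a : ℕ → R) : ℕ ⥤ Contramodule R :=
  Functor.ofSequence (X := fun _ => freeOne R) fun n => rightMul (a n)

instance (a : ℕ → R) : HasColimit (bassDiagram a) := hasColimit_algebra _

/-- The Bass flat left `R`-contramodule of the sequence `a`, the direct limit in `R-contra`. -/
noncomputable def bassFlat (a : ℕ → R) : Contramodule R := colimit (bassDiagram a)

end Contramodules

/-- The right ideal `a₀a₁⋯aₙ₋₁R + I`; for `n = 0` the product is empty and this is `R`. -/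
def bassChain {R : Type*} [Ring R] (a : ℕ → R) (I : Submodule Rᵐᵒᵖ R) (n : ℕ) :
    Submodule Rᵐᵒᵖ R :=
  Submodule.span Rᵐᵒᵖ {((List.range n).map a).prod} ⊔ I

/- For a discrete right `R`-module `N` and an abelian group `V`, the group `Hom(N, V)` is a left
`R`-contramodule, and a homomorphism `R[[X]] → Hom(N, V)` evaluated at `r` and `n` only depends on
the finitely many nonzero products `n r_x`. In `B` the generators satisfy `g 0 = a₀⋯aₖ₋₁ g k`, so
under any homomorphism from `B` to a free contramodule the coefficients of the image of `g 0` lie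
in `J = ⋂ₖ (a₀⋯aₖ₋₁R + I)`. If `B` is a retract of a free contramodule, then every homomorphism
`B → Hom(R/J, V)` therefore sends `g 0` to a map vanishing at `1`. Taking for `V` the direct limit
of `R/J → R/J → ⋯` along the actions of `a₀, a₁, …`, with `g k` going to the `k`-th canonical map,
gives `a₀⋯aₘ₋₁ ∈ J` for some `m`, and the chain is constant from there on. -/

namespace ConvFam

open MulOpposite

section RightMultiplication

variable {R : Type*} [Ring R] [UniformSpace R] [IsUniformAddGroup R] [IsTopologicalRing R]
  [IsLinearTopology Rᵐᵒᵖ R]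

theorem pair_mulRight {X : Type*} (c : R) (r : ConvFam R X) (φ : X → R) :
    pair (mulRight c r) φ = pair r fun x => c * φ x :=
  tsum_congr fun x => mul_assoc (r.1 x) c (φ x)

variable [CompleteSpace R] [T2Space R]

theorem map_mulRight {X Y : Type*} (f : X → Y) (c : R) (r : ConvFam R X) :
    map f (mulRight c r) = mulRight c (map f r) :=
  Subtype.ext <| funext fun _ =>
    (summable_of_tendsto (r.2.comp Subtype.val_injective.tendsto_cofinite)).tsum_mul_right c

end RightMultiplication

section Contratensor

variable {R : Type*} [Ring R] [TopologicalSpace R]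
  {N : Type*} [AddCommGroup N] [Module Rᵐᵒᵖ N] [TopologicalSpace N] [DiscreteTopology N]
  [ContinuousSMul Rᵐᵒᵖ N]

theorem finite_support_op_smul {X : Type*} (r : ConvFam R X) (n : N) :
    (Function.support fun x => op (r.1 x) • n).Finite := by
  have h : Tendsto (fun x => op (r.1 x) • n) cofinite (𝓝 ((0 : Rᵐᵒᵖ) • n)) :=
    ((continuous_op.tendsto 0).comp r.2).smul_const n
  rw [zero_smul] at h
  exact eventually_cofinite.1 (h.eventually_mem (isOpen_discrete {0} |>.mem_nhds rfl))

/-- The pairing `N × R[[X]] → N[X]`, `(n, ∑ r_x x) ↦ ∑ (n r_x) x`, of a discrete right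
`R`-module `N` with `R[[X]]`; it identifies the contratensor product `N ⊙ R[[X]]` with `N[X]`.
Right multiplication by `c : R` is the scalar action of `op c`. -/
noncomputable def contratensor {X : Type*} (r : ConvFam R X) : N →+ (X →₀ N) where
  toFun n := Finsupp.ofSupportFinite (fun x => op (r.1 x) • n) (finite_support_op_smul r n)
  map_zero' := Finsupp.ext fun _ => smul_zero _
  map_add' _ _ := Finsupp.ext fun _ => smul_add _ _ _

theorem contratensor_apply {X : Type*} (r : ConvFam R X) (n : N) (x : X) :
    contratensor r n x = op (r.1 x) • n := rfl

end Contratensor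

section ContratensorFunctor

variable {R : Type*} [Ring R] [UniformSpace R] [IsUniformAddGroup R] [IsTopologicalRing R]
  [IsLinearTopology Rᵐᵒᵖ R] [CompleteSpace R] [T2Space R]
  {N : Type*} [AddCommGroup N] [Module Rᵐᵒᵖ N] [TopologicalSpace N] [DiscreteTopology N]
  [ContinuousSMul Rᵐᵒᵖ N]

theorem op_pair_smul {X : Type*} (r : ConvFam R X) (φ : X → R) (n : N) :
    op (pair r φ) • n = (contratensor r n).sum fun x m => op (φ x) • m := by
  let evalAt : R →+ N := ((smulAddHom Rᵐᵒᵖ N).flip n).comp (opAddEquiv : R ≃+ Rᵐᵒᵖ).toAddMonoidHom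
  have continuous_evalAt : Continuous evalAt := continuous_op.smul continuous_const
  calc op (pair r φ) • n = ∑' x, op (r.1 x * φ x) • n :=
        (summable_of_tendsto (tendsto_mul r.2 φ)).map_tsum evalAt continuous_evalAt
    _ = ∑' x, op (φ x) • contratensor r n x :=
        tsum_congr fun x => by rw [contratensor_apply, op_mul, mul_smul]
    _ = (contratensor r n).sum fun x m => op (φ x) • m :=
        tsum_eq_sum fun x hx => by rw [Finsupp.notMem_support_iff.1 hx, smul_zero]

theorem contratensor_mulRight_point {X : Type*} (c : R) (x : X) (n : N) :
    contratensor (mulRight c (point R x)) n = Finsupp.single x (op c • n) := by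
  classical
  ext y
  change op ((point R x).1 y * c) • n = _
  rw [point_apply, Finsupp.single_apply]
  split_ifs <;> simp

theorem contratensor_point {X : Type*} (x : X) (n : N) :
    contratensor (point R x) n = Finsupp.single x n := by
  classical
  ext y
  rw [contratensor_apply, Finsupp.single_apply, point_apply]
  split_ifs <;> simp

theorem contratensor_map {X Y : Type*} (f : X → Y) (r : ConvFam R X) (n : N) :
    contratensor (map f r) n = Finsupp.mapDomain f (contratensor r n) := by
  classical
  ext y
  rw [contratensor_apply, map_apply, op_pair_smul, Finsupp.mapDomain, Finsupp.sum_apply]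
  refine Finsupp.sum_congr fun x _ => ?_
  rw [Finsupp.single_apply]
  split_ifs <;> simp

theorem contratensor_join {X : Type*} (r : ConvFam R (ConvFam R X)) (n : N) :
    contratensor (join r) n = (contratensor r n).sum fun s => contratensor s := by
  ext x
  rw [contratensor_apply, join_apply, op_pair_smul, Finsupp.sum_apply]
  rfl

end ContratensorFunctor

end ConvFam

section RightIdeals

open MulOpposite

variable {R : Type*} [Ring R]

theorem op_smul_mkQ_one_eq_zero_iff {J : Submodule Rᵐᵒᵖ R} {c : R} :
    op c • J.mkQ 1 = 0 ↔ c ∈ J := by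
  rw [← map_smul, op_smul_eq_mul, one_mul, Submodule.mkQ_apply, Submodule.Quotient.mk_eq_zero]

variable (a : ℕ → R) (I : Submodule Rᵐᵒᵖ R)

theorem prod_mul_mem_bassChain (n : ℕ) (c : R) :
    ((List.range n).map a).prod * c ∈ bassChain a I n :=
  Submodule.mem_sup_left ((Submodule.span Rᵐᵒᵖ _).smul_mem (op c)
    (Submodule.mem_span_singleton_self _))

theorem bassChain_antitone : Antitone (bassChain a I) := by
  refine antitone_nat_of_succ_le fun n => sup_le ?_ le_sup_right
  rw [Submodule.span_singleton_le_iff_mem, List.prod_range_succ]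
  exact prod_mul_mem_bassChain a I n _

end RightIdeals

section TailGerm

open MulOpposite

variable {R : Type*} [Ring R] {N : Type*} [AddCommGroup N] [Module Rᵐᵒᵖ N]

/-- The canonical map from the `k`-th term `N` to `lim→ (N → N → ⋯)`, the transition maps being
the actions of `a 0, a 1, …`; the direct limit is realized inside the germs at infinity of
sequences in `N`. -/
def tailGerm (a : ℕ → R) (k : ℕ) : N →+ Germ (atTop : Filter ℕ) N :=
  (Germ.coeAddHom atTop).comp <|
    AddMonoidHom.mk' (fun n m => op ((List.Ico k m).map a).prod • n)
      fun _ _ => funext fun _ => smul_add _ _ _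

theorem tailGerm_succ (a : ℕ → R) (k : ℕ) (n : N) :
    tailGerm a (k + 1) (op (a k) • n) = tailGerm a k n := by
  refine Germ.coe_eq.2 ((eventually_gt_atTop k).mono fun m hm => ?_)
  change op ((List.Ico (k + 1) m).map a).prod • op (a k) • n = op ((List.Ico k m).map a).prod • n
  rw [List.Ico.eq_cons hm, List.map_cons, List.prod_cons, op_mul, mul_smul]

end TailGerm

section Contramodules

open ConvFam MulOpposite

variable {R : Type u} [Ring R] [UniformSpace R] [IsUniformAddGroup R] [IsTopologicalRing R]
  [CompleteSpace R] [T2Space R] [IsLinearTopology Rᵐᵒᵖ R]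

namespace Contramodule

theorem hom_act {A B : Contramodule R} (t : A ⟶ B) (r : ConvFam R A.A) :
    t.f (A.a r) = B.a (map t.f r : ConvFam R B.A) :=
  (ConcreteCategory.congr_hom t.h r).symm

/-- The left `R`-module structure underlying a contramodule: `c • x` is the value of the
one-term formal linear combination `c x`. -/
noncomputable def smul {A : Contramodule R} (c : R) (x : A.A) : A.A :=
  A.a (mulRight c (point R x) : ConvFam R A.A)

theorem hom_smul {A B : Contramodule R} (t : A ⟶ B) (c : R) (x : A.A) :
    t.f (smul c x) = smul c (t.f x) := by
  rw [smul, hom_act, map_mulRight, ← point_naturality, smul]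

variable (R) in
/-- The free contramodule `R[[X]]`. -/
noncomputable abbrev free (X : Type u) : Contramodule R := (contraMonad R).free.obj X

/-- The free generator `1 · x` of `R[[X]]`. -/
noncomputable def of {X : Type u} (x : X) : (free R X).A := point R x

/-- An element of the free contramodule on `X`, as a family of coefficients indexed by `X`. -/
def coeff {X : Type u} (r : (free R X).A) : ConvFam R X := r

theorem coeff_smul {X : Type u} (c : R) (r : (free R X).A) (x : X) :
    (coeff (smul c r)).1 x = c * (coeff r).1 x :=
  (pair_mulRight c (point R r) fun s => (coeff s).1 x).trans (pair_point r _)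

theorem free_hom_apply {X : Type u} {A : Contramodule R} (g : free R X ⟶ A) (r : (free R X).A) :
    g.f r = A.a (map (fun x => g.f (of x)) (coeff r) : ConvFam R A.A) :=
  calc g.f r = g.f (join (map (point R) (coeff r))) :=
        congrArg g.f (join_map_point (coeff r)).symm
    _ = A.a (map g.f (map (point R) (coeff r)) : ConvFam R A.A) := hom_act g _
    _ = A.a (map (fun x => g.f (of x)) (coeff r) : ConvFam R A.A) :=
      congrArg A.a (map_map (point R) g.f (coeff r)).symm

theorem free_hom_ext {X : Type u} {A : Contramodule R} {f g : free R X ⟶ A}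
    (h : ∀ x, f.f (of x) = g.f (of x)) : f = g := by
  ext r : 4
  change f.f r = g.f r
  rw [free_hom_apply f, free_hom_apply g, funext h]

theorem exists_free_hom {X : Type u} {A : Contramodule R} (k : X → A.A) :
    ∃ g : free R X ⟶ A, ∀ x, g.f (of x) = k x := by
  refine ⟨((contraMonad R).adj.homEquiv X A).symm (TypeCat.ofHom k), fun x => ?_⟩
  have h := ((contraMonad R).adj.homEquiv X A).apply_symm_apply (TypeCat.ofHom k)
  rw [Adjunction.homEquiv_unit] at h
  exact ConcreteCategory.congr_hom h x

theorem exists_retraction_free {P : Contramodule R} (hP : Projective P) :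
    ∃ (s : P ⟶ free R P.A) (ε : free R P.A ⟶ P), s ≫ ε = 𝟙 P := by
  obtain ⟨s, hs⟩ := hP.factors (𝟙 P) ((contraMonad R).adj.counit.app P)
  exact ⟨s, _, hs⟩

theorem rightMul_of (c : R) (x : PUnit.{u + 1}) : (rightMul c).f (of x) = smul c (of x) := by
  refine Subtype.ext (funext fun y => ?_)
  refine Eq.trans ?_ (coeff_smul c (of x) y).symm
  change (point R x).1 y * c = c * (point R x).1 y
  simp only [point_apply, if_true, one_mul, mul_one]

end Contramodule

section HomContramodule

variable {N : Type u} [AddCommGroup N] [Module Rᵐᵒᵖ N] [TopologicalSpace N] [DiscreteTopology N]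
  [ContinuousSMul Rᵐᵒᵖ N] {V : Type u} [AddCommGroup V]

/-- The contramodule structure map of `Hom_ℤ(N, V)`: it sends `∑ r_f f` to
`n ↦ ∑ f(n r_f)`, a finite sum because `N` is discrete. -/
noncomputable def homAct (r : ConvFam R (N →+ V)) : N →+ V :=
  (Finsupp.liftAddHom id).comp (contratensor r)

theorem homAct_map {X : Type u} (f : X → (N →+ V)) (r : ConvFam R X) (n : N) :
    homAct (map f r) n = (contratensor r n).sum fun x => f x := by
  change Finsupp.liftAddHom id (contratensor (map f r) n) = _
  rw [contratensor_map, Finsupp.liftAddHom_apply, Finsupp.sum_mapDomain_index_addMonoidHom]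
  rfl

theorem homAct_point (f : N →+ V) : homAct (point R f) = f := by
  ext n
  change Finsupp.liftAddHom id (contratensor (point R f) n) = _
  rw [contratensor_point, Finsupp.liftAddHom_apply_single, id_eq]

theorem homAct_join (r : ConvFam R (ConvFam R (N →+ V))) :
    homAct (join r) = homAct (map homAct r) := by
  ext n
  rw [homAct_map]
  change Finsupp.liftAddHom id (contratensor (join r) n) = _
  rw [contratensor_join, map_finsuppSum]
  rfl

variable (R N V) in
/-- The contramodule `Hom_ℤ(N, V)` attached to a discrete right `R`-module `N` and an abelian
group `V`. -/
noncomputable def homContramodule : Contramodule R where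
  A := N →+ V
  a := TypeCat.ofHom (homAct : ConvFam R (N →+ V) → (N →+ V))
  unit := by ext f : 3; exact homAct_point f
  assoc := by ext r : 3; exact homAct_join r

namespace homContramodule

open Contramodule

/-- An element of `Hom_ℤ(N, V)`, as an additive map. -/
def toAddMonoidHom (f : (homContramodule R N V).A) : N →+ V := f

theorem toAddMonoidHom_smul (c : R) (f : (homContramodule R N V).A) (n : N) :
    toAddMonoidHom (smul c f) n = toAddMonoidHom f (op c • n) := by
  change Finsupp.liftAddHom id (contratensor (mulRight c (point R (toAddMonoidHom f))) n) = _
  rw [contratensor_mulRight_point, Finsupp.liftAddHom_apply_single, id_eq]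

theorem toAddMonoidHom_free_hom {X : Type u} (g : free R X ⟶ homContramodule R N V)
    (r : (free R X).A) (n : N) :
    toAddMonoidHom (g.f r) n
      = (contratensor (coeff r) n).sum fun x => toAddMonoidHom (g.f (of x)) := by
  rw [free_hom_apply]
  exact homAct_map (fun x => toAddMonoidHom (g.f (of x))) (coeff r) n

theorem hom_apply_eq_zero_of_projective {P : Contramodule R} (hP : Projective P) {x : P.A} {n : N}
    (hx : ∀ t : P ⟶ free R P.A, contratensor (coeff (t.f x)) n = 0)
    (d : P ⟶ homContramodule R N V) : toAddMonoidHom (d.f x) n = 0 := by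
  obtain ⟨s, ε, hs⟩ := exists_retraction_free hP
  have hd : d.f x = (ε ≫ d).f (s.f x) :=
    calc d.f x = ((s ≫ ε) ≫ d).f x := by rw [hs, Category.id_comp]
      _ = (ε ≫ d).f (s.f x) := rfl
  rw [hd, toAddMonoidHom_free_hom, hx s, Finsupp.sum_zero_index]

end homContramodule

end HomContramodule

namespace bassFlat

open Contramodule

/-- The canonical map from the `k`-th copy of `R` to the Bass contramodule. -/
noncomputable def incl (a : ℕ → R) (k : ℕ) : freeOne R ⟶ bassFlat a := colimit.ι (bassDiagram a) k

/-- The image in the Bass contramodule of the generator of the `k`-th copy of `R`. -/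
noncomputable def gen (a : ℕ → R) (k : ℕ) : (bassFlat a).A := (incl a k).f (of PUnit.unit)

theorem bassDiagram_map_succ (a : ℕ → R) (k : ℕ) :
    (bassDiagram a).map (homOfLE (Nat.le_add_right k 1)) = rightMul (a k) :=
  Functor.ofSequence_map_homOfLE_succ _ k

theorem rightMul_comp_incl (a : ℕ → R) (k : ℕ) : rightMul (a k) ≫ incl a (k + 1) = incl a k := by
  rw [← bassDiagram_map_succ]
  exact colimit.w (bassDiagram a) _

theorem gen_eq_smul_gen_succ (a : ℕ → R) (k : ℕ) : gen a k = smul (a k) (gen a (k + 1)) :=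
  calc gen a k = (incl a (k + 1)).f ((rightMul (a k)).f (of PUnit.unit)) := by
        rw [gen, ← rightMul_comp_incl]; rfl
    _ = smul (a k) (gen a (k + 1)) := by rw [rightMul_of, hom_smul, gen]

theorem exists_hom {a : ℕ → R} {A : Contramodule R} {x : ℕ → A.A}
    (hx : ∀ k, x k = smul (a k) (x (k + 1))) :
    ∃ d : bassFlat a ⟶ A, ∀ k, d.f (gen a k) = x k := by
  choose g hg using fun k => exists_free_hom fun _ : PUnit.{u + 1} => x k
  have hcomp (k : ℕ) : rightMul (a k) ≫ g (k + 1) = g k :=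
    free_hom_ext fun y =>
      calc (g (k + 1)).f ((rightMul (a k)).f (of y)) = smul (a k) (x (k + 1)) := by
            rw [rightMul_of, hom_smul, hg]
        _ = (g k).f (of y) := by rw [hg, ← hx]
  let c : Cocone (bassDiagram a) :=
    { pt := A
      ι := NatTrans.ofSequence g fun k => by
        rw [bassDiagram_map_succ]
        exact (hcomp k).trans (Category.comp_id _).symm }
  refine ⟨colimit.desc (bassDiagram a) c, fun k => ?_⟩
  have hdesc : incl a k ≫ colimit.desc (bassDiagram a) c = g k := colimit.ι_desc c k
  rw [← hg k PUnit.unit, ← hdesc]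
  rfl

theorem coeff_hom_gen_zero {a : ℕ → R} {X : Type u} (t : bassFlat a ⟶ free R X) (x : X) (k : ℕ) :
    (coeff (t.f (gen a 0))).1 x
      = ((List.range k).map a).prod * (coeff (t.f (gen a k))).1 x := by
  induction k with
  | zero => rw [List.range_zero, List.map_nil, List.prod_nil, one_mul]
  | succ k ih =>
    rw [ih, gen_eq_smul_gen_succ, hom_smul, coeff_smul, List.prod_range_succ, mul_assoc]

theorem coeff_hom_gen_zero_mem_iInf_bassChain {a : ℕ → R} {X : Type u}
    (t : bassFlat a ⟶ free R X) (x : X) (I : Submodule Rᵐᵒᵖ R) :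
    (coeff (t.f (gen a 0))).1 x ∈ ⨅ k, bassChain a I k :=
  Submodule.mem_iInf _ |>.2 fun k => by
    rw [coeff_hom_gen_zero t x k]
    exact prod_mul_mem_bassChain a I k _

theorem exists_prod_smul_eq_zero {N : Type u} [AddCommGroup N]
    [Module Rᵐᵒᵖ N] [TopologicalSpace N] [DiscreteTopology N] [ContinuousSMul Rᵐᵒᵖ N]
    {a : ℕ → R} (hB : Projective (bassFlat a)) {n : N}
    (hn : ∀ t : bassFlat a ⟶ free R (bassFlat a).A,
      contratensor (coeff (t.f (gen a 0))) n = 0) :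
    ∃ m, op ((List.range m).map a).prod • n = 0 := by
  obtain ⟨d, hd⟩ := exists_hom (A := homContramodule R N (Germ (atTop : Filter ℕ) N))
    (x := tailGerm a) fun k => AddMonoidHom.ext fun n =>
      (tailGerm_succ a k n).symm.trans (homContramodule.toAddMonoidHom_smul _ _ n).symm
  have hzero : tailGerm a 0 n = 0 :=
    (congrArg (homContramodule.toAddMonoidHom · n) (hd 0)).symm.trans
      (homContramodule.hom_apply_eq_zero_of_projective hB hn d)
  obtain ⟨m, hm⟩ := (Germ.coe_eq.1 hzero).exists
  exact ⟨m, by rw [← List.Ico.zero_bot]; exact hm⟩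

end bassFlat

end Contramodules

theorem proposition4p3 {R : Type u} [Ring R] [UniformSpace R] [IsUniformAddGroup R]
    [IsTopologicalRing R] [CompleteSpace R] [T2Space R] [IsLinearTopology Rᵐᵒᵖ R]
    (a : ℕ → R) (hB : Projective (bassFlat a))
    (I : Submodule Rᵐᵒᵖ R) (hI : IsOpen (I : Set R)) :
    ∃ m, ∀ n, m ≤ n → bassChain a I n = bassChain a I m := by
  let J := ⨅ k, bassChain a I k
  have hJ : IsOpen (J : Set R) :=
    AddSubgroup.isOpen_mono (H₁ := I.toAddSubgroup) (H₂ := J.toAddSubgroup)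
      (le_iInf fun _ => le_sup_right : I ≤ J) hI
  have : DiscreteTopology (R ⧸ J) := QuotientAddGroup.discreteTopology (N := J.toAddSubgroup) hJ
  obtain ⟨m, hm⟩ := bassFlat.exists_prod_smul_eq_zero (n := J.mkQ 1) hB fun t =>
    Finsupp.ext fun x => op_smul_mkQ_one_eq_zero_iff.2
      (bassFlat.coeff_hom_gen_zero_mem_iInf_bassChain t x I)
  refine ⟨m, fun n hn => (bassChain_antitone a I hn).antisymm (sup_le ?_ le_sup_right)⟩
  rw [Submodule.span_singleton_le_iff_mem]
  exact iInf_le (bassChain a I) n (op_smul_mkQ_one_eq_zero_iff.1 hm)
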